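/- Conventions. A monoid is a commutative, cancellative semigroup with unit element. For a monoid $H$ let $H_{\mathrm{red}}=\{aH^\times : a\in H\}$ be its associated reduced monoid, and let $\mathsf Z(H)$ be the free abelian monoid whose basis is the set of atoms of $H_{\mathrm{red}}$, with $|z|$ the length of $z\in\mathsf Z(H)$ and $\pi:\mathsf Z(H)\to H_{\mathrm{red}}$ the canonical homomorphism. For $a\in H$ put $\mathsf Z(a)=\pi^{-1}(aH^\times)$ (the factorizations of $a$), $\mathsf Z_k(a)=\{z\in\mathsf Z(a): |z|=k\}$ and $\mathsf L(a)=\{|z| : z\in\mathsf Z(a)\}$, and use the same notation for elements of $H_{\mathrm{red}}$. For $z,z'\in\mathsf Z(H)$ with $g=\gcd(z,z')$ let $\mathsf d(z,z')=\max\{|zg^{-1}|,|z'g^{-1}|\}$; for a set $X\subset\mathsf Z(H)$ let $\mathsf d(z,X)=\min_{x\in X}\mathsf d(z,x)$. The monotone catenary degree $\mathsf c_{\mathrm{mon}}(H)$ is the supremum over $a\in H$ of the smallest $N\in\mathbb N_0\cup\{\infty\}$ such that any two $z,z'\in\mathsf Z(a)$ can be joined by a chain $z=z_0,\dots,z_k=z'$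 in $\mathsf Z(a)$ with $\mathsf d(z_{i-1},z_i)\le N$ for all $i\in[1,k]$ and with $|z_0|\le\dots\le|z_k|$ or $|z_0|\ge\dots\ge|z_k|$. The successive distance $\delta(H)$ is the supremum over $z\in\mathsf Z(H)$ of the smallest $N\in\mathbb N_0$ such that $\mathsf d(z,\mathsf Z_k(\pi(z)))\le N$ for every $k$ for which $k$ and $|z|$ are adjacent elements of $\mathsf L(\pi(z))$ (that is, distinct elements with no further element of $\mathsf L(\pi(z))$ between them). Let $\varphi:H\to\mathcal F(P)$ be a monoid homomorphism into the free abelian monoid with basis $P$ that is a divisor homomorphism ($\varphi(a)\mid\varphi(b)$ implies $a\mid b$) and cofinal (every $x\in\mathcal F(P)$ divides some $\varphi(u)$, $u\in H$); in particular $H$ is a Krull monoid. Its class group is $G=\mathsf q(\mathcal F(P))/\mathsf q(\varphi(H))$, where $\mathsf q$ denotes the quotient group, and $G_P=\{[p] : p\in P\}\subset G$ is the set of classes containing prime divisors. Proposition 7.1. Let $H$ be a Krull monoid and $\varphi:H\to\mathcal F(P)$ a cofinal divisor homomorphism into a free abelian monoid whose class group $G$ is infinite cyclic, identified with $\mathbb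 Z$. Let $d_1,d_2$ be integers with $3\le d_1<d_2$, $\gcd(d_1,d_2)=1$ and $d_1-1\nmid d_2-1$. Suppose that $-d_1,\,-d_2,\,d_1d_2\in G_P$ and that $G_P$ contains infinitely many positive integers congruent to $d_1+d_2$ modulo $d_1d_2$. Let $d=\gcd(d_1-1,d_2-1)$. Then for all integers $M,N\ge 0$ there exist $a\in H$ and $z,z'\in\mathsf Z(a)$ such that $\mathsf L(a)$ has a minimum and a maximum and $$|z'|=|z|+d\le |z|+d_1-2,$$ $$\min\mathsf L(a)+N\le |z|\le\max\mathsf L(a)-N,$$ $$\mathsf d\Bigl(z,\ \bigcup_{i=1}^{|z|+d_1-2}\mathsf Z_i(a)\setminus\{z\}\Bigr)>M.$$ In particular, $\mathsf c_{\mathrm{mon}}(H)=\infty$ and $\delta(H)=\infty$. -/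

import Mathlib

/-! A monoid is a commutative cancellative monoid, written multiplicatively. -/

namespace FactorizationTheory

noncomputable section

/-! ### Divisor homomorphisms and class groups -/

/-- The free abelian monoid with basis `P`, written multiplicatively: its elements are the finite
multisets of elements of `P`. -/
abbrev FreeAbMonoid (P : Type*) : Type _ := Multiplicative (Multiset P)

/-- The basis element `p` of the free abelian monoid with basis `P`. -/
def FreeAbMonoid.of {P : Type*} (p : P) : FreeAbMonoid P := Multiplicative.ofAdd {p}

/-- `φ` is a divisor homomorphism: `φ a ∣ φ b` implies `a ∣ b`. -/
def IsDivisorHom {H D : Type*} [CommMonoid H] [CommMonoid D] (φ : H →* D) : Prop :=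
  ∀ a b : H, φ a ∣ φ b → a ∣ b

/-- `φ` is cofinal: every element of the target divides an element of the image. -/
def IsCofinal {H D : Type*} [CommMonoid H] [CommMonoid D] (φ : H →* D) : Prop :=
  ∀ x : D, ∃ u : H, x ∣ φ u

/-- The subgroup of the quotient group of `D` generated by the image of `φ`, that is, the quotient
group of `φ(H)`. -/
def principalSubgroup {H D : Type*} [CommMonoid H] [CommMonoid D] (φ : H →* D) :
    Subgroup (Algebra.GrothendieckGroup D) :=
  Subgroup.closure (Set.range fun h : H => Algebra.GrothendieckGroup.of (φ h))

/-- The class group of `φ`: the quotient group of `D` modulo the quotient group of `φ(H)`. -/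
abbrev ClassGroupOf {H D : Type*} [CommMonoid H] [CommMonoid D] (φ : H →* D) : Type _ :=
  Algebra.GrothendieckGroup D ⧸ principalSubgroup φ

/-- The class containing the element `x` of `D`. -/
def classOf {H D : Type*} [CommMonoid H] [CommMonoid D] (φ : H →* D) (x : D) : ClassGroupOf φ :=
  QuotientGroup.mk (Algebra.GrothendieckGroup.of x)

/-- The set of classes containing prime divisors, as a set of integers, for a class group that is
identified with `ℤ` by the isomorphism `Φ`. -/
def primeClasses {H P : Type*} [CommMonoid H] (φ : H →* FreeAbMonoid P)
    (Φ : ClassGroupOf φ ≃* Multiplicative ℤ) : Set ℤ :=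
  Set.range fun p : P => Multiplicative.toAdd (Φ (classOf φ (FreeAbMonoid.of p)))

/-! ### Factorizations

The reduced monoid of `H` is `Associates H`. -/

/-- The atoms of the reduced monoid of `H`. -/
abbrev AtomRed (H : Type*) [CommMonoid H] : Type _ := {u : Associates H // Irreducible u}

/-- The factorization monoid of `H`, the free abelian monoid whose basis consists of the atoms of
the reduced monoid (here in additive notation). The length of `z` is `Multiset.card z`. -/
abbrev Factorization (H : Type*) [CommMonoid H] : Type _ := Multiset (AtomRed H)

/-- The factorization homomorphism, from the factorization monoid to the reduced monoid. -/
def factProd {H : Type*} [CommMonoid H] (z : Factorization H) : Associates H :=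
  (z.map Subtype.val).prod

/-- The set of factorizations of an element of the reduced monoid. -/
def factorizationsRed {H : Type*} [CommMonoid H] (x : Associates H) : Set (Factorization H) :=
  {z | factProd z = x}

/-- The set of factorizations `Z(a)` of an element `a` of `H`. -/
def factorizations {H : Type*} [CommMonoid H] (a : H) : Set (Factorization H) :=
  factorizationsRed (Associates.mk a)

/-- The set of lengths of an element of the reduced monoid. -/
def lengthsRed {H : Type*} [CommMonoid H] (x : Associates H) : Set ℕ :=
  Multiset.card '' factorizationsRed x

/-- The set of lengths `L(a)` of an element `a` of `H`. -/
def lengths {H : Type*} [CommMonoid H] (a : H) : Set ℕ :=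
  lengthsRed (Associates.mk a)

/-- The factorizations of length `k` of an element of the reduced monoid. -/
def factorizationsRedOfLength {H : Type*} [CommMonoid H] (x : Associates H) (k : ℕ) :
    Set (Factorization H) :=
  {z ∈ factorizationsRed x | Multiset.card z = k}

/-- The set `Z_k(a)` of factorizations of length `k` of an element `a` of `H`. -/
def factorizationsOfLength {H : Type*} [CommMonoid H] (a : H) (k : ℕ) : Set (Factorization H) :=
  factorizationsRedOfLength (Associates.mk a) k

open Classical in
/-- The distance of two factorizations: cancel their greatest common divisor `z ∩ z'` and take the
larger one of the two remaining lengths. -/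
def factDist {H : Type*} [CommMonoid H] (z z' : Factorization H) : ℕ :=
  max (Multiset.card (z - z ∩ z')) (Multiset.card (z' - z ∩ z'))

/-- The distance of two sets of factorizations, the minimum of the distances of their elements
(and `⊤` if one of the sets is empty). -/
def factSetDist {H : Type*} [CommMonoid H] (X Y : Set (Factorization H)) : ℕ∞ :=
  ⨅ x ∈ X, ⨅ y ∈ Y, (factDist x y : ℕ∞)

/-! ### The monotone catenary degree -/

/-- `z` and `z'` can be concatenated by a monotone `N`-chain of factorizations of `a`. -/
def HasMonotoneChain {H : Type*} [CommMonoid H] (a : H) (N : ℕ∞) (z z' : Factorization H) : Prop :=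
  ∃ (k : ℕ) (f : ℕ → Factorization H), f 0 = z ∧ f k = z' ∧
    (∀ i ≤ k, f i ∈ factorizations a) ∧
    (∀ i < k, (factDist (f i) (f (i + 1)) : ℕ∞) ≤ N) ∧
    ((∀ i < k, Multiset.card (f i) ≤ Multiset.card (f (i + 1))) ∨
      (∀ i < k, Multiset.card (f (i + 1)) ≤ Multiset.card (f i)))

/-- The monotone catenary degree of an element: the smallest `N` such that any two factorizations
of `a` can be concatenated by a monotone `N`-chain. -/
def monCatenaryDegreeElt {H : Type*} [CommMonoid H] (a : H) : ℕ∞ :=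
  sInf {N : ℕ∞ | ∀ z ∈ factorizations a, ∀ z' ∈ factorizations a, HasMonotoneChain a N z z'}

/-- The monotone catenary degree of `H`. -/
def monCatenaryDegree (H : Type*) [CommMonoid H] : ℕ∞ :=
  ⨆ a : H, monCatenaryDegreeElt a

/-! ### The successive distance -/

/-- `k` and `l` are adjacent elements of `L`: they are distinct elements of `L` and no further
element of `L` lies between them. -/
def AdjacentIn (L : Set ℕ) (k l : ℕ) : Prop :=
  k ≠ l ∧ L ∩ Set.Icc (min k l) (max k l) = {k, l}

/-- The successive distance of a factorization `z`: the smallest `N` such that, for every `k` for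
which `k` and the length of `z` are adjacent lengths, `z` has distance at most `N` to the set of
factorizations of length `k` of the same element. -/
def successiveDistanceAt {H : Type*} [CommMonoid H] (z : Factorization H) : ℕ∞ :=
  sInf {N : ℕ∞ | ∀ k : ℕ, AdjacentIn (lengthsRed (factProd z)) k (Multiset.card z) →
    factSetDist {z} (factorizationsRedOfLength (factProd z) k) ≤ N}

/-- The successive distance of `H`. -/
def successiveDistance (H : Type*) [CommMonoid H] : ℕ∞ :=
  ⨆ z : Factorization H, successiveDistanceAt z

end

end FactorizationTheory

open FactorizationTheory

/-! Passing to divisors identifies the reduced monoid with the multisets of primes of class zero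
(`exists_divisorModel`). Choose primes p₁, p₂, q, r of classes -d₁, -d₂, d₁d₂ and n = d₁ + d₂ + m
d₁d₂, where the infinitude hypothesis allows m to be as large as desired. An atom supported on these
primes is one of U₁ = q p₁^d₂, U₂ = q p₂^d₁, W₁ = r^d₁ p₁ⁿ, W₂ = r^d₂ p₂ⁿ or some Vᵢ = r p₁^(1 + i
d₂) p₂^(1 + (m - i) d₁), because every nontrivial zero-sum exponent vector dominates one of these
(`ZeroSum.dominates`).

Take z = W₁^W V₀^(d₂ - 1) U₂^B. Comparing multiplicities of primes (`exponents_rigid`), any other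
factorization of the same element either contains more than m copies of W₂ or of U₁, neither of
which occurs in z, or it replaces x > 0 copies of W₁ without using W₂, which adds (d₁ - 1)x > d₁ - 2
to the length. Hence z has distance greater than m from every other factorization of length at most
|z| + d₁ - 2.

Using W₂ as well, Bézout's identity for d₁ - 1 and d₂ - 1 gives a factorization of length |z| + d
(`exists_length_shift`); non-divisibility makes d ≤ d₁ - 2. Large W and B leave room for much
shorter and much longer factorizations. Both invariants are infinite because leaving z within
lengths at most |z| + d costs more than m. -/

namespace FactorizationTheory

/-! ### The divisor map of a reduced monoid with class group `ℤ` -/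

/-- An additive class map `σ` on the free abelian monoid with basis `P`, and a divisor map `ψ`
identifying the reduced monoid of `H` with the monoid of multisets of class zero. -/
structure DivisorModel {H P : Type*} [CommMonoid H] (σ : Multiset P →+ ℤ)
    (ψ : Associates H → Multiset P) : Prop where
  map_one : ψ 1 = 0
  map_mul : ∀ x y, ψ (x * y) = ψ x + ψ y
  injective : Function.Injective ψ
  mem_range_iff : ∀ m, (∃ x, ψ x = m) ↔ σ m = 0

/-- The class map on multisets of prime divisors, for a class group identified with `ℤ`. -/
noncomputable def classMap {H P : Type*} [CommMonoid H] (φ : H →* FreeAbMonoid P)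
    (Φ : ClassGroupOf φ ≃* Multiplicative ℤ) : Multiset P →+ ℤ where
  toFun m := Multiplicative.toAdd (Φ (classOf φ (Multiplicative.ofAdd m)))
  map_zero' := by
    simp [classOf]
  map_add' x y := by
    simp [classOf]

/-- Every element of the generated subgroup is a fraction φ(a)/φ(b). If it lies in the free monoid,
then φ(b) divides φ(a), so b divides a and the fraction is the image of the quotient. -/
theorem mem_principalSubgroup_iff {H P : Type*} [CancelCommMonoid H] {φ : H →* FreeAbMonoid P}
    (hdiv : IsDivisorHom φ) (x : FreeAbMonoid P) :
    Algebra.GrothendieckGroup.of x ∈ principalSubgroup φ ↔ ∃ h, φ h = x := by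
  constructor
  · intro hx
    have key : ∀ g ∈ principalSubgroup φ, ∃ a b : H,
        g * Algebra.GrothendieckGroup.of (φ b) = Algebra.GrothendieckGroup.of (φ a) := by
      intro g hg
      refine Subgroup.closure_induction ?_ ?_ ?_ ?_ hg
      · rintro _ ⟨h, rfl⟩
        exact ⟨h, 1, by simp⟩
      · exact ⟨1, 1, by simp⟩
      · rintro g g' _ _ ⟨a, b, h⟩ ⟨a', b', h'⟩
        refine ⟨a * a', b * b', ?_⟩
        rw [map_mul, map_mul, map_mul, map_mul, ← h, ← h', mul_mul_mul_comm]
      · rintro g _ ⟨a, b, h⟩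
        refine ⟨b, a, ?_⟩
        rw [← h, inv_mul_cancel_left]
    obtain ⟨a, b, h⟩ := key _ hx
    rw [← map_mul] at h
    have h' : x * φ b = φ a := Algebra.GrothendieckGroup.of_injective h
    obtain ⟨c, rfl⟩ := hdiv b a ⟨x, by rw [← h', mul_comm]⟩
    refine ⟨c, ?_⟩
    rw [map_mul, mul_comm] at h'
    exact (mul_left_cancel h').symm
  · rintro ⟨h, rfl⟩
    exact Subgroup.subset_closure ⟨h, rfl⟩

theorem classMap_eq_zero_iff {H P : Type*} [CancelCommMonoid H] {φ : H →* FreeAbMonoid P}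
    (hdiv : IsDivisorHom φ) (Φ : ClassGroupOf φ ≃* Multiplicative ℤ) (m : Multiset P) :
    classMap φ Φ m = 0 ↔ ∃ h, φ h = Multiplicative.ofAdd m := by
  rw [← mem_principalSubgroup_iff hdiv, ← QuotientGroup.eq_one_iff]
  change Multiplicative.toAdd (Φ (classOf φ (Multiplicative.ofAdd m))) = 0 ↔ _
  rw [toAdd_eq_zero, MulEquiv.map_eq_one_iff]
  rfl

theorem exists_divisorModel {H P : Type*} [CancelCommMonoid H] {φ : H →* FreeAbMonoid P}
    (hdiv : IsDivisorHom φ) (Φ : ClassGroupOf φ ≃* Multiplicative ℤ) :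
    ∃ ψ : Associates H → Multiset P, DivisorModel (classMap φ Φ) ψ := by
  -- Divisibility of multisets is antisymmetric, so associated elements have the same divisor.
  have hresp : ∀ a b : H, Associated a b → φ a = φ b := by
    intro a b hab
    have h1 : φ a ∣ φ b := map_dvd φ hab.dvd
    have h2 : φ b ∣ φ a := map_dvd φ hab.symm.dvd
    obtain ⟨c, hc⟩ := h1
    obtain ⟨e, he⟩ := h2
    have h1 : Multiplicative.toAdd (φ a) ≤ Multiplicative.toAdd (φ b) :=
      Multiset.le_iff_exists_add.2 ⟨Multiplicative.toAdd c, by rw [hc]; rfl⟩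
    have h2 : Multiplicative.toAdd (φ b) ≤ Multiplicative.toAdd (φ a) :=
      Multiset.le_iff_exists_add.2 ⟨Multiplicative.toAdd e, by rw [he]; rfl⟩
    exact Multiplicative.toAdd.injective (le_antisymm h1 h2)
  let ψ : Associates H → Multiset P :=
    fun x => Quotient.lift (s := Associated.setoid H) (fun a => Multiplicative.toAdd (φ a))
      (fun a b hab => congrArg Multiplicative.toAdd (hresp a b hab)) x
  have hψ : ∀ a : H, ψ (Associates.mk a) = Multiplicative.toAdd (φ a) := fun a => rfl
  refine ⟨ψ, ?_, ?_, ?_, ?_⟩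
  · rw [← Associates.mk_one, hψ, map_one]; rfl
  · intro x y
    obtain ⟨a, rfl⟩ := Associates.exists_rep x
    obtain ⟨b, rfl⟩ := Associates.exists_rep y
    rw [Associates.mk_mul_mk, hψ, hψ, hψ, map_mul]; rfl
  · intro x y hxy
    obtain ⟨a, rfl⟩ := Associates.exists_rep x
    obtain ⟨b, rfl⟩ := Associates.exists_rep y
    rw [hψ, hψ] at hxy
    have hxy : φ a = φ b := Multiplicative.toAdd.injective hxy
    rw [Associates.mk_eq_mk_iff_associated]
    have h1 : a ∣ b := hdiv _ _ (by rw [hxy])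
    have h2 : b ∣ a := hdiv _ _ (by rw [hxy])
    obtain ⟨c, rfl⟩ := h1
    obtain ⟨e, he⟩ := h2
    rw [mul_assoc, left_eq_mul] at he
    exact ⟨Units.mkOfMulEqOne c e he, rfl⟩
  · intro m
    rw [classMap_eq_zero_iff hdiv]
    constructor
    · rintro ⟨x, rfl⟩
      obtain ⟨a, rfl⟩ := Associates.exists_rep x
      exact ⟨a, rfl⟩
    · rintro ⟨a, ha⟩
      exact ⟨Associates.mk a, by rw [hψ, ha]; rfl⟩

namespace DivisorModel

variable {H P : Type*} [CancelCommMonoid H] {σ : Multiset P →+ ℤ} {ψ : Associates H → Multiset P}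

theorem class_eq_zero (h : DivisorModel σ ψ) (x : Associates H) : σ (ψ x) = 0 :=
  (h.mem_range_iff _).1 ⟨x, rfl⟩

theorem eq_one_iff (h : DivisorModel σ ψ) (x : Associates H) : ψ x = 0 ↔ x = 1 := by
  rw [← h.map_one, h.injective.eq_iff]

/-- The divisor of an irreducible element is a minimal nonempty multiset of class zero. -/
theorem eq_of_le_irreducible (h : DivisorModel σ ψ) {x : Associates H} (hx : Irreducible x)
    {m : Multiset P} (hm : m ≤ ψ x) (hσ : σ m = 0) (h0 : m ≠ 0) : ψ x = m := by
  obtain ⟨k, hk⟩ := Multiset.le_iff_exists_add.1 hm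
  have hσk : σ k = 0 := by
    have := h.class_eq_zero x
    rw [hk, map_add, hσ, zero_add] at this
    exact this
  obtain ⟨y, hy⟩ := (h.mem_range_iff m).2 hσ
  obtain ⟨w, hw⟩ := (h.mem_range_iff k).2 hσk
  have hxy : x = y * w := h.injective (by rw [h.map_mul, hy, hw, hk])
  rcases hx.isUnit_or_isUnit hxy with hu | hu
  · rw [Associates.isUnit_iff_eq_one, ← h.eq_one_iff, hy] at hu
    exact absurd hu h0
  · rw [Associates.isUnit_iff_eq_one, ← h.eq_one_iff, hw] at hu
    rw [hk, hu, add_zero]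

/-- A minimal nonempty multiset of class zero is the divisor of an atom. -/
theorem exists_atom (h : DivisorModel σ ψ) {m : Multiset P} (hσ : σ m = 0) (h0 : m ≠ 0)
    (hmin : ∀ k ≤ m, σ k = 0 → k = 0 ∨ k = m) : ∃ u : AtomRed H, ψ u = m := by
  obtain ⟨x, hx⟩ := (h.mem_range_iff m).2 hσ
  refine ⟨⟨x, ?_, ?_⟩, hx⟩
  · rw [Associates.isUnit_iff_eq_one, ← h.eq_one_iff, hx]
    exact h0
  · intro y w hyw
    have hadd : m = ψ y + ψ w := by rw [← hx, hyw, h.map_mul]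
    rcases hmin (ψ y) (by rw [hadd]; exact Multiset.le_add_right _ _) (h.class_eq_zero y) with
      hy | hy
    · left
      rwa [Associates.isUnit_iff_eq_one, ← h.eq_one_iff]
    · right
      rw [Associates.isUnit_iff_eq_one, ← h.eq_one_iff]
      rw [hy] at hadd
      simpa using hadd

theorem map_factProd (h : DivisorModel σ ψ) (z : Factorization H) :
    ψ (factProd z) = (z.map fun u => ψ u.1).sum := by
  induction z using Multiset.induction with
  | empty => simpa [factProd] using h.map_one
  | cons u z ih =>
    have : factProd (u ::ₘ z) = u.1 * factProd z := by simp [factProd]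
    rw [this, h.map_mul, ih]
    simp

theorem le_of_mem (h : DivisorModel σ ψ) {z : Factorization H} {u : AtomRed H} (hu : u ∈ z) :
    ψ u.1 ≤ ψ (factProd z) := by
  rw [h.map_factProd]
  exact Multiset.single_le_sum (fun _ _ => Multiset.zero_le _) _
    (Multiset.mem_map_of_mem (fun u : AtomRed H => ψ u.1) hu)

end DivisorModel

/-! ### Distances and the global invariants -/

/-- Copies of an atom absent from `z` survive cancellation of the common part. -/
theorem le_factDist_of_replicate_le {H : Type*} [CommMonoid H] {z z' : Factorization H}
    {u : AtomRed H} {k : ℕ} (hu : u ∉ z) (hk : Multiset.replicate k u ≤ z') :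
    k ≤ factDist z z' := by
  classical
  unfold factDist
  refine le_trans ?_ (le_max_right _ _)
  rw [← Multiset.le_count_iff_replicate_le] at hk
  have h0 : Multiset.count u (z ∩ z') = 0 :=
    Multiset.count_eq_zero.2 fun h => hu (Multiset.mem_of_le Multiset.inter_le_left h)
  have h1 : k ≤ Multiset.count u (z' - z ∩ z') := by
    rw [Multiset.count_sub, h0, Nat.sub_zero]
    exact hk
  convert h1.trans (Multiset.count_le_card u _)

/-- If `z` is at distance greater than `M` from every other factorization of length at most that
of the longer factorization `z'`, then every monotone chain from `z` to `z'` has a step of length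
greater than `M`. -/
theorem lt_monCatenaryDegreeElt {H : Type*} [CommMonoid H] {a : H} {z z' : Factorization H}
    {M : ℕ} (hz : z ∈ factorizations a) (hz' : z' ∈ factorizations a)
    (hlt : Multiset.card z < Multiset.card z')
    (hfar : ∀ y ∈ factorizations a, Multiset.card y ≤ Multiset.card z' → y ≠ z →
      M < factDist z y) : (M : ℕ∞) < monCatenaryDegreeElt a := by
  unfold monCatenaryDegreeElt
  rw [← not_le]
  intro hle
  -- Passing to the strict bound `M + 1` produces an actual member `N` of the set below it.
  have hlt' : sInf {N : ℕ∞ | ∀ z ∈ factorizations a, ∀ z' ∈ factorizations a,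
      HasMonotoneChain a N z z'} < ((M + 1 : ℕ) : ℕ∞) :=
    lt_of_le_of_lt hle (by exact_mod_cast Nat.lt_succ_self M)
  obtain ⟨N, hN, hNM⟩ := sInf_lt_iff.1 hlt'
  obtain ⟨k, f, h0, hk, hmem, hstep, hmono⟩ := hN z hz z' hz'
  have hle' : ∀ i ≤ k, Multiset.card (f i) ≤ Multiset.card z' := by
    rcases hmono with hm | hm
    · intro i hi
      rw [← hk]
      refine Nat.decreasingInduction' (P := fun j => Multiset.card (f j) ≤ Multiset.card (f k))
        ?_ hi le_rfl
      intro j hj _ h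
      exact (hm j hj).trans h
    · exfalso
      have : ∀ i ≤ k, Multiset.card (f i) ≤ Multiset.card z := by
        intro i
        induction i with
        | zero => intro _; rw [h0]
        | succ i ih => intro hi; exact (hm i hi).trans (ih (Nat.le_of_succ_le hi))
      have := this k le_rfl
      rw [hk] at this
      omega
  -- All lengths in the chain are at most that of `z'`, so the first step away from `z` would
  -- already exceed `M`.
  have hall : ∀ i ≤ k, f i = z := by
    intro i
    induction i with
    | zero => intro _; exact h0
    | succ i ih =>
      intro hi
      by_contra hne
      have h1 := hfar _ (hmem (i + 1) hi) (hle' (i + 1) hi) hne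
      have h2 := hstep i hi
      rw [ih (Nat.le_of_succ_le hi)] at h2
      have h3 : ((factDist z (f (i + 1)) : ℕ) : ℕ∞) < ((M + 1 : ℕ) : ℕ∞) := lt_of_le_of_lt h2 hNM
      rw [Nat.cast_lt] at h3
      omega
  have := hall k le_rfl
  rw [hk] at this
  rw [this] at hlt
  exact lt_irrefl _ hlt

/-- If `z` is at distance greater than `M` from every other factorization of length at most that
of the longer factorization `z'`, then the successive distance of `z` is at least `M`. -/
theorem le_successiveDistanceAt {H : Type*} [CommMonoid H] {a : H} {z z' : Factorization H}
    {M : ℕ} (hz : z ∈ factorizations a) (hz' : z' ∈ factorizations a)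
    (hlt : Multiset.card z < Multiset.card z')
    (hfar : ∀ y ∈ factorizations a, Multiset.card y ≤ Multiset.card z' → y ≠ z →
      M < factDist z y) : (M : ℕ∞) ≤ successiveDistanceAt z := by
  classical
  have hpz : factProd z = Associates.mk a := hz
  -- The least length above that of `z` is adjacent to it and does not exceed that of `z'`.
  have hex : ∃ k, k ∈ lengthsRed (Associates.mk a) ∧ Multiset.card z < k :=
    ⟨_, ⟨z', hz', rfl⟩, hlt⟩
  obtain ⟨hk, hzk⟩ := Nat.find_spec hex
  have hmin := fun j => @Nat.find_min' _ _ hex j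
  set k := Nat.find hex
  unfold successiveDistanceAt
  refine le_sInf fun N hN => ?_
  rw [Set.mem_ofPred_eq, hpz] at hN
  refine le_trans ?_ (hN k ⟨hzk.ne', ?_⟩)
  · refine le_iInf₂ fun x hx => le_iInf₂ fun y hy => ?_
    rw [Set.mem_singleton_iff] at hx
    subst hx
    have hyk : Multiset.card y = k := hy.2
    have := hfar y hy.1 (by rw [hyk]; exact hmin _ ⟨⟨z', hz', rfl⟩, hlt⟩)
      (by rintro rfl; omega)
    exact_mod_cast this.le
  · rw [min_eq_right hzk.le, max_eq_left hzk.le]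
    ext j
    simp only [Set.mem_inter_iff, Set.mem_Icc, Set.mem_insert_iff, Set.mem_singleton_iff]
    constructor
    · rintro ⟨hj, h1, h2⟩
      rcases h1.eq_or_lt with h | h
      · exact Or.inr h.symm
      · exact Or.inl (le_antisymm h2 (hmin j ⟨hj, h⟩))
    · rintro (rfl | rfl)
      · exact ⟨hk, hzk.le, le_rfl⟩
      · exact ⟨⟨z, hz, rfl⟩, le_rfl, hzk.le⟩

/-! ### Arithmetic of the zero-sum equation -/

/-- Solutions of the zero-sum equation for the classes `-d₁`, `-d₂`, `d₁ d₂` and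
`d₁ + d₂ + m d₁ d₂`. -/
def ZeroSum (d₁ d₂ m a b c e : ℕ) : Prop :=
  d₁ * a + d₂ * b = d₁ * d₂ * c + (d₁ + d₂ + m * d₁ * d₂) * e

theorem coprime_left_class {d₁ d₂ : ℕ} (h : Nat.Coprime d₁ d₂) (m : ℕ) :
    Nat.Coprime d₁ (d₁ + d₂ + m * d₁ * d₂) := by
  have : d₁ + d₂ + m * d₁ * d₂ = d₂ + d₁ * (1 + m * d₂) := by ring
  rw [this]
  exact Nat.coprime_add_mul_left_right _ _ _ |>.2 h

theorem coprime_right_class {d₁ d₂ : ℕ} (h : Nat.Coprime d₁ d₂) (m : ℕ) :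
    Nat.Coprime d₂ (d₁ + d₂ + m * d₁ * d₂) := by
  have : d₁ + d₂ + m * d₁ * d₂ = d₁ + d₂ * (1 + m * d₁) := by ring
  rw [this]
  exact Nat.coprime_add_mul_left_right _ _ _ |>.2 h.symm

/-- Every nontrivial solution of the zero-sum equation dominates one of the basic solutions. -/
theorem ZeroSum.dominates {d₁ d₂ m a b c e : ℕ} (h1 : 0 < d₁) (h2 : 0 < d₂) (hm : 0 < m)
    (hcop : Nat.Coprime d₁ d₂) (h : ZeroSum d₁ d₂ m a b c e) (h0 : 0 < a + b + c + e) :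
    (d₂ ≤ a ∧ 1 ≤ c) ∨ (d₁ ≤ b ∧ 1 ≤ c) ∨
    (d₁ + d₂ + m * d₁ * d₂ ≤ a ∧ d₁ ≤ e) ∨ (d₁ + d₂ + m * d₁ * d₂ ≤ b ∧ d₂ ≤ e) ∨
    ∃ i ≤ m, 1 + i * d₂ ≤ a ∧ 1 + (m - i) * d₁ ≤ b ∧ 1 ≤ e := by
  unfold ZeroSum at h
  rcases Nat.eq_zero_or_pos c with rfl | hc
  · have he : 0 < e := by
      rcases Nat.eq_zero_or_pos e with rfl | he
      · exfalso
        have : d₁ * a = 0 ∧ d₂ * b = 0 := by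
          constructor <;> nlinarith [Nat.zero_le (d₁ * a), Nat.zero_le (d₂ * b)]
        have ha : a = 0 := by simpa [h1.ne'] using this.1
        have hb : b = 0 := by simpa [h2.ne'] using this.2
        omega
      · exact he
    rw [mul_zero, zero_add] at h
    rcases Nat.eq_zero_or_pos b with rfl | hb
    · right; right; left
      rw [mul_zero, add_zero] at h
      have hd : d₁ ∣ e := (coprime_left_class hcop m).dvd_of_dvd_mul_left ⟨a, h.symm⟩
      obtain ⟨f, rfl⟩ := hd
      have hf : 0 < f := Nat.pos_of_mul_pos_left he
      have ha : a = (d₁ + d₂ + m * d₁ * d₂) * f := by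
        apply Nat.eq_of_mul_eq_mul_left h1
        rw [h]; ring
      exact ⟨by rw [ha]; exact Nat.le_mul_of_pos_right _ hf, Nat.le_mul_of_pos_right _ hf⟩
    rcases Nat.eq_zero_or_pos a with rfl | ha
    · right; right; right; left
      rw [mul_zero, zero_add] at h
      have hd : d₂ ∣ e := (coprime_right_class hcop m).dvd_of_dvd_mul_left ⟨b, h.symm⟩
      obtain ⟨f, rfl⟩ := hd
      have hf : 0 < f := Nat.pos_of_mul_pos_left he
      have hb : b = (d₁ + d₂ + m * d₁ * d₂) * f := by
        apply Nat.eq_of_mul_eq_mul_left h2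
        rw [h]; ring
      exact ⟨by rw [hb]; exact Nat.le_mul_of_pos_right _ hf, Nat.le_mul_of_pos_right _ hf⟩
    right; right; right; right
    obtain ⟨a, rfl⟩ : ∃ a', a = a' + 1 := ⟨a - 1, by omega⟩
    obtain ⟨b, rfl⟩ : ∃ b', b = b' + 1 := ⟨b - 1, by omega⟩
    have hmod := Nat.div_add_mod a d₂
    have hlt := Nat.mod_lt a h2
    -- Here `a` and `b` are the exponents diminished by one; the index is the smaller of `m` and `a
    -- / d₂`.
    rcases le_or_gt m (a / d₂) with hi | hi
    · refine ⟨m, le_rfl, ?_, by simp, he⟩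
      have := (Nat.le_div_iff_mul_le h2).1 hi
      omega
    · refine ⟨a / d₂, hi.le, ?_, ?_, he⟩
      · have := Nat.div_mul_le_self a d₂
        omega
      · obtain ⟨j, hj⟩ : ∃ j, m = a / d₂ + 1 + j := ⟨m - (a / d₂ + 1), by omega⟩
        set i := a / d₂
        have hsub : m - i = j + 1 := by omega
        rw [hsub]
        have hge : (j + 1) * d₁ ≤ b := by
          -- For `e = 1`, coprimality forces d₂ to divide `a` and the bound is an equality. For `e ≥
          -- 2` the right side is too large to allow a smaller `b`.
          rcases Nat.eq_or_lt_of_le he with he1 | he1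
          · have he1 : e = 1 := he1.symm
            subst he1
            have hab : d₁ * a + d₂ * b = m * d₁ * d₂ := by linarith
            have hda : d₂ ∣ a := by
              apply hcop.symm.dvd_of_dvd_mul_left
              exact (Nat.dvd_add_left (Dvd.intro b rfl)).1 ⟨m * d₁, by rw [hab]; ring⟩
            have hr : a % d₂ = 0 := Nat.mod_eq_zero_of_dvd hda
            rw [hr, add_zero] at hmod
            have : d₂ * b = d₂ * ((j + 1) * d₁) := by
              have e1 : d₁ * a = d₁ * (d₂ * i) := by rw [hmod]
              have e2 : m * d₁ * d₂ = d₁ * (d₂ * i) + d₂ * ((j + 1) * d₁) := by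
                rw [hj]; ring
              omega
            exact (Nat.eq_of_mul_eq_mul_left h2 this).ge
          · by_contra hb'
            rw [not_le] at hb'
            have e1 : d₂ * b < d₂ * ((j + 1) * d₁) := Nat.mul_lt_mul_of_pos_left hb' h2
            have e2 : a < d₂ * (i + 1) := by rw [mul_add, mul_one]; omega
            have e3 : d₁ * a < d₁ * (d₂ * (i + 1)) := Nat.mul_lt_mul_of_pos_left e2 h1
            have e4 : (d₁ + d₂ + m * d₁ * d₂) * 2 ≤ (d₁ + d₂ + m * d₁ * d₂) * e :=
              Nat.mul_le_mul_left _ he1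
            have e5 : d₂ * ((j + 1) * d₁) + d₁ * (d₂ * (i + 1)) = m * d₁ * d₂ + d₁ * d₂ := by
              rw [hj]; ring
            have e6 : d₁ * d₂ ≤ m * d₁ * d₂ := by
              rw [mul_assoc]; exact Nat.le_mul_of_pos_left _ hm
            nlinarith
        omega
  · by_cases ha : d₂ ≤ a
    · exact Or.inl ⟨ha, hc⟩
    by_cases hb : d₁ ≤ b
    · exact Or.inr (Or.inl ⟨hb, hc⟩)
    -- With `a < d₂` and `b < d₁` the left side is below 2d₁d₂, so `e = 0` and `c = 1`; coprimality
    -- then gives `a = 0`, hence `b = d₁`.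
    exfalso
    rw [not_le] at ha hb
    have e1 : d₁ * a + d₁ ≤ d₁ * d₂ := by
      calc d₁ * a + d₁ = d₁ * (a + 1) := by ring
        _ ≤ _ := Nat.mul_le_mul_left _ ha
    have e2 : d₂ * b + d₂ ≤ d₁ * d₂ := by
      calc d₂ * b + d₂ = d₂ * (b + 1) := by ring
        _ ≤ d₂ * d₁ := Nat.mul_le_mul_left _ hb
        _ = _ := mul_comm _ _
    have e6 : d₁ * d₂ ≤ m * d₁ * d₂ := by
      rw [mul_assoc]; exact Nat.le_mul_of_pos_left _ hm
    have e7 : 0 < d₁ * d₂ := Nat.mul_pos h1 h2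
    have he : e = 0 := by
      rcases Nat.eq_zero_or_pos e with he | he
      · exact he
      · exfalso
        have : d₁ + d₂ + m * d₁ * d₂ ≤ (d₁ + d₂ + m * d₁ * d₂) * e := Nat.le_mul_of_pos_right _ he
        have : d₁ * d₂ ≤ d₁ * d₂ * c := Nat.le_mul_of_pos_right _ hc
        omega
    subst he
    have hc1 : c = 1 := by
      by_contra hc1
      have : d₁ * d₂ * 2 ≤ d₁ * d₂ * c := Nat.mul_le_mul_left _ (by omega)
      omega
    subst hc1
    rw [mul_one, mul_zero, add_zero] at h
    have hda : d₂ ∣ a := by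
      apply hcop.symm.dvd_of_dvd_mul_left
      exact (Nat.dvd_add_left (Dvd.intro b rfl)).1 ⟨d₁, by rw [h]; ring⟩
    have ha0 : a = 0 := Nat.eq_zero_of_dvd_of_lt hda ha
    subst ha0
    rw [mul_zero, zero_add] at h
    omega

/-! ### Minimality of the basic solutions. -/

theorem ZeroSum.minimal_left {d₁ d₂ m a c : ℕ} (h1 : 0 < d₁) (hc : c ≤ 1)
    (h : ZeroSum d₁ d₂ m a 0 c 0) : (a = 0 ∧ c = 0) ∨ (a = d₂ ∧ c = 1) := by
  unfold ZeroSum at h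
  rw [mul_zero, mul_zero, add_zero, add_zero, mul_assoc] at h
  have h := Nat.eq_of_mul_eq_mul_left h1 h
  interval_cases c <;> simp_all

theorem ZeroSum.minimal_right {d₁ d₂ m b c : ℕ} (h2 : 0 < d₂) (hc : c ≤ 1)
    (h : ZeroSum d₁ d₂ m 0 b c 0) : (b = 0 ∧ c = 0) ∨ (b = d₁ ∧ c = 1) := by
  unfold ZeroSum at h
  rw [mul_zero, mul_zero, zero_add, add_zero, mul_comm d₁, mul_assoc] at h
  have h := Nat.eq_of_mul_eq_mul_left h2 h
  interval_cases c <;> simp_all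

/-- For `e = 1` the two upper bounds add up exactly to the required total, so both are attained. -/
theorem ZeroSum.minimal_mixed {d₁ d₂ m i a b e : ℕ} (h1 : 0 < d₁) (h2 : 0 < d₂) (hi : i ≤ m)
    (ha : a ≤ 1 + i * d₂) (hb : b ≤ 1 + (m - i) * d₁) (he : e ≤ 1)
    (h : ZeroSum d₁ d₂ m a b 0 e) :
    (a = 0 ∧ b = 0 ∧ e = 0) ∨ (a = 1 + i * d₂ ∧ b = 1 + (m - i) * d₁ ∧ e = 1) := by
  unfold ZeroSum at h
  obtain ⟨j, rfl⟩ := Nat.exists_eq_add_of_le hi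
  rw [Nat.add_sub_cancel_left] at *
  have k1 := Nat.mul_le_mul_left d₁ ha
  have k2 := Nat.mul_le_mul_left d₂ hb
  interval_cases e
  · left
    have e1 : d₁ * a = 0 := by simp only [mul_zero] at h; omega
    have e2 : d₂ * b = 0 := by simp only [mul_zero] at h; omega
    exact ⟨by simpa [h1.ne'] using e1, by simpa [h2.ne'] using e2, rfl⟩
  · right
    have e3 : (d₁ + d₂ + (i + j) * d₁ * d₂) = d₁ * (1 + i * d₂) + d₂ * (1 + j * d₁) := by ring
    rw [mul_zero, zero_add, mul_one, e3] at h
    exact ⟨Nat.eq_of_mul_eq_mul_left h1 (by omega), Nat.eq_of_mul_eq_mul_left h2 (by omega), rfl⟩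

theorem ZeroSum.minimal_pure_left {d₁ d₂ m a e : ℕ} (h1 : 0 < d₁) (hcop : Nat.Coprime d₁ d₂)
    (he : e ≤ d₁) (h : ZeroSum d₁ d₂ m a 0 0 e) :
    (a = 0 ∧ e = 0) ∨ (a = d₁ + d₂ + m * d₁ * d₂ ∧ e = d₁) := by
  unfold ZeroSum at h
  rw [mul_zero, mul_zero, zero_add, add_zero] at h
  have hd : d₁ ∣ e := (coprime_left_class hcop m).dvd_of_dvd_mul_left ⟨a, h.symm⟩
  rcases Nat.eq_zero_or_pos e with rfl | hpos
  · left
    exact ⟨by simpa [h1.ne'] using h, rfl⟩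
  · right
    have he' : e = d₁ := le_antisymm he (Nat.le_of_dvd hpos hd)
    subst he'
    exact ⟨Nat.eq_of_mul_eq_mul_left h1 (by rw [h, mul_comm]), rfl⟩

theorem ZeroSum.minimal_pure_right {d₁ d₂ m b e : ℕ} (h2 : 0 < d₂) (hcop : Nat.Coprime d₁ d₂)
    (he : e ≤ d₂) (h : ZeroSum d₁ d₂ m 0 b 0 e) :
    (b = 0 ∧ e = 0) ∨ (b = d₁ + d₂ + m * d₁ * d₂ ∧ e = d₂) := by
  unfold ZeroSum at h
  rw [mul_zero, mul_zero, zero_add, zero_add] at h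
  have hd : d₂ ∣ e := (coprime_right_class hcop m).dvd_of_dvd_mul_left ⟨b, h.symm⟩
  rcases Nat.eq_zero_or_pos e with rfl | hpos
  · left
    exact ⟨by simpa [h2.ne'] using h, rfl⟩
  · right
    have he' : e = d₂ := le_antisymm he (Nat.le_of_dvd hpos hd)
    subst he'
    exact ⟨Nat.eq_of_mul_eq_mul_left h2 (by rw [h, mul_comm]), rfl⟩

/-- The exponents of a factorization of the special element that is not too long are either those
of the special factorization or at least one of two exponents is large. -/
theorem exponents_rigid {d₁ d₂ m W B w₁ w₂ u₁ u₂ v s : ℕ} (h3 : 3 ≤ d₁) (hlt : d₁ < d₂)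
    (hs : s ≤ m * v) (hr : d₁ * w₁ + d₂ * w₂ + v = d₁ * W + (d₂ - 1)) (hq : u₁ + u₂ = B)
    (hp : (d₁ + d₂ + m * d₁ * d₂) * w₁ + d₂ * u₁ + v + d₂ * s
      = (d₁ + d₂ + m * d₁ * d₂) * W + (d₂ - 1))
    (hlen : w₁ + w₂ + u₁ + u₂ + v ≤ W + B + (d₂ - 1) + (d₁ - 2)) :
    m < w₂ ∨ m < u₁ ∨ (w₁ = W ∧ w₂ = 0 ∧ v = d₂ - 1 ∧ u₁ = 0 ∧ s = 0) := by
  obtain ⟨t, rfl⟩ : ∃ t, d₂ = t + 1 := ⟨d₂ - 1, by omega⟩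
  obtain ⟨c, rfl⟩ : ∃ c, d₁ = c + 2 := ⟨d₁ - 2, by omega⟩
  simp only [Nat.add_sub_cancel] at *
  zify at *
  obtain ⟨x, hx⟩ : ∃ x : ℤ, x = W - w₁ := ⟨_, rfl⟩
  have hw₁ : (w₁ : ℤ) = W - x := by omega
  rw [hw₁] at hr hp hlen ⊢
  have hv : (v : ℤ) = (c + 2) * x + t - (t + 1) * w₂ := by linarith
  -- Eliminating `v` between the counts of r and p₁ and dividing by d₂; `x` is the number of copies
  -- of W₁ given up.
  have hkey : (w₂ : ℤ) + x * (1 + m * (c + 2)) = u₁ + s := by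
    have : ((t : ℤ) + 1) * (w₂ + x * (1 + m * (c + 2))) = (t + 1) * (u₁ + s) := by
      rw [hv] at hp
      linarith
    exact mul_left_cancel₀ (by positivity) this
  rcases lt_trichotomy x 0 with hx0 | hx0 | hx0
  · left
    nlinarith [mul_nonneg (Int.natCast_nonneg m) (Int.natCast_nonneg c)]
  · subst hx0
    right; right
    have hw : (w₂ : ℤ) = 0 := by
      by_contra hne
      have : (1 : ℤ) ≤ w₂ := by omega
      nlinarith
    rw [hw] at hkey hv
    exact ⟨by ring, hw, by linarith, by omega, by omega⟩
  · rcases Nat.eq_zero_or_pos w₂ with hw | hw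
    -- Without W₂ the length grows by exactly (d₁ - 1)x, beyond the allowed d₁ - 2.
    · exfalso
      subst hw
      push_cast at *
      nlinarith
    -- Since `s ≤ m * v`, the terms in m d₁x cancel, leaving u₁ ≥ w₂ + x + m + m d₂(w₂ - 1) > m.
    · right; left
      have hw' : (1 : ℤ) ≤ w₂ := by exact_mod_cast hw
      have e1 : (u₁ : ℤ) = w₂ + x + x * (m * (c + 2)) - s := by linarith
      have e2 : (s : ℤ) ≤ m * ((c + 2) * x + t - (t + 1) * w₂) := by rw [← hv]; exact hs
      have e3 : (0 : ℤ) ≤ m * ((t + 1) * (w₂ - 1)) :=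
        mul_nonneg (Int.natCast_nonneg m) (mul_nonneg (by positivity) (by linarith))
      linarith

/-- There are exponents realizing the difference `gcd (d₁ - 1) (d₂ - 1)` of lengths. -/
theorem exists_length_shift {d₁ d₂ : ℕ} (h3 : 3 ≤ d₁) (hlt : d₁ < d₂) :
    ∃ x y : ℕ, (d₁ - 1) * x = (d₂ - 1) * y + Nat.gcd (d₁ - 1) (d₂ - 1) ∧
      d₂ * y ≤ d₁ * x + (d₂ - 1) := by
  obtain ⟨c, rfl⟩ : ∃ c, d₁ = c + 1 := ⟨d₁ - 1, by omega⟩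
  obtain ⟨t, rfl⟩ : ∃ t, d₂ = t + 1 := ⟨d₂ - 1, by omega⟩
  simp only [Nat.add_sub_cancel]
  have hc : (0 : ℤ) < c := by omega
  have hbez := Nat.gcd_eq_gcd_ab c t
  have hg : (Nat.gcd c t : ℤ) ≤ t - c := by
    have h1 : Nat.gcd c t ∣ t - c := Nat.dvd_sub (Nat.gcd_dvd_right c t) (Nat.gcd_dvd_left c t)
    have := Nat.le_of_dvd (by omega) h1
    omega
  set g := Nat.gcd c t
  -- Reducing the Bézout coefficient modulo d₁ - 1 gives y < d₁ - 1 < d₂ - 1, which makes d₂y ≤ d₁x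
  -- + (d₂ - 1) hold.
  obtain ⟨y, hy⟩ := Int.eq_ofNat_of_zero_le (Int.emod_nonneg (-Nat.gcdB c t) hc.ne')
  have hylt := Int.emod_lt_of_pos (-Nat.gcdB c t) hc
  have hdiv := Int.mul_ediv_add_emod (-Nat.gcdB c t) c
  rw [hy] at hylt hdiv
  obtain ⟨q, hq⟩ : ∃ q, q = (-Nat.gcdB c t) / (c : ℤ) := ⟨_, rfl⟩
  rw [← hq] at hdiv
  have hX : (c : ℤ) * (Nat.gcdA c t - t * q) = t * y + g := by
    have : (y : ℤ) = -Nat.gcdB c t - c * q := by linarith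
    rw [this, hbez]; ring
  have hpos : 0 ≤ Nat.gcdA c t - t * q := by
    have : 0 ≤ (c : ℤ) * (Nat.gcdA c t - t * q) := by rw [hX]; positivity
    exact nonneg_of_mul_nonneg_right this hc
  obtain ⟨x, hx⟩ := Int.eq_ofNat_of_zero_le hpos
  rw [hx] at hX
  refine ⟨x, y, by exact_mod_cast hX, ?_⟩
  zify
  have hb : (x : ℤ) - y ≤ t - c := by
    have : (c : ℤ) * (x - y) ≤ c * (t - c) := by
      have h1 : (c : ℤ) * (x - y) = (t - c) * y + g := by linarith
      have h2 : ((t : ℤ) - c) * y ≤ (t - c) * (c - 1) :=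
        mul_le_mul_of_nonneg_left (by omega) (by omega)
      linarith
    exact le_of_mul_le_mul_left this hc
  have : (0 : ℤ) ≤ g := by positivity
  nlinarith

/-! ### Multisets supported on four elements -/

section Block

variable {P : Type*} {p₁ p₂ q r : P}

/-- The multiset `p₁ᵃ p₂ᵇ qᶜ rᵉ`. -/
def block (p₁ p₂ q r : P) (a b c e : ℕ) : Multiset P :=
  Multiset.replicate a p₁ + Multiset.replicate b p₂ + Multiset.replicate c q +
    Multiset.replicate e r

theorem block_zero : block p₁ p₂ q r 0 0 0 0 = 0 := by simp [block]

theorem block_add (a b c e a' b' c' e' : ℕ) :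
    block p₁ p₂ q r a b c e + block p₁ p₂ q r a' b' c' e' =
      block p₁ p₂ q r (a + a') (b + b') (c + c') (e + e') := by
  simp only [block, Multiset.replicate_add]
  abel

theorem nsmul_block (k a b c e : ℕ) :
    k • block p₁ p₂ q r a b c e = block p₁ p₂ q r (k * a) (k * b) (k * c) (k * e) := by
  simp only [block, nsmul_add, Multiset.nsmul_replicate]

theorem block_le_block {a b c e a' b' c' e' : ℕ} (ha : a ≤ a') (hb : b ≤ b') (hc : c ≤ c')
    (he : e ≤ e') : block p₁ p₂ q r a b c e ≤ block p₁ p₂ q r a' b' c' e' :=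
  add_le_add (add_le_add (add_le_add (Multiset.replicate_mono _ ha)
    (Multiset.replicate_mono _ hb)) (Multiset.replicate_mono _ hc)) (Multiset.replicate_mono _ he)

theorem exists_add_of_le_add {k s t : Multiset P} (h : k ≤ s + t) :
    ∃ k₁ k₂, k₁ ≤ s ∧ k₂ ≤ t ∧ k = k₁ + k₂ := by
  classical
  exact ⟨k ∩ s, k - s, Multiset.inter_le_right, tsub_le_iff_left.2 h, by
    rw [add_comm, Multiset.sub_add_inter]⟩

theorem exists_eq_block_of_le {k : Multiset P} {a b c e : ℕ} (h : k ≤ block p₁ p₂ q r a b c e) :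
    ∃ a' ≤ a, ∃ b' ≤ b, ∃ c' ≤ c, ∃ e' ≤ e, k = block p₁ p₂ q r a' b' c' e' := by
  obtain ⟨kabc, ke, habc, hke, rfl⟩ := exists_add_of_le_add h
  obtain ⟨kab, kc, hab, hkc, rfl⟩ := exists_add_of_le_add habc
  obtain ⟨ka, kb, hka, hkb, rfl⟩ := exists_add_of_le_add hab
  obtain ⟨a', ha, rfl⟩ := Multiset.le_replicate_iff.1 hka
  obtain ⟨b', hb, rfl⟩ := Multiset.le_replicate_iff.1 hkb
  obtain ⟨c', hc, rfl⟩ := Multiset.le_replicate_iff.1 hkc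
  obtain ⟨e', he, rfl⟩ := Multiset.le_replicate_iff.1 hke
  exact ⟨_, ha, _, hb, _, hc, _, he, rfl⟩

end Block

/-! ### Four primes of prescribed classes. -/

/-- Elements `p₁, p₂, q, r` of classes `-d₁`, `-d₂`, `d₁ d₂` and `d₁ + d₂ + m d₁ d₂`. -/
structure SpecialPrimes {P : Type*} (σ : Multiset P →+ ℤ) (p₁ p₂ q r : P) (d₁ d₂ m : ℕ) :
    Prop where
  one_lt : 1 < d₁
  lt : d₁ < d₂
  coprime : Nat.Coprime d₁ d₂
  pos : 0 < m
  class_left : σ {p₁} = -(d₁ : ℤ)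
  class_right : σ {p₂} = -(d₂ : ℤ)
  class_mul : σ {q} = (d₁ : ℤ) * d₂
  class_add : σ {r} = (d₁ : ℤ) + d₂ + m * d₁ * d₂

namespace SpecialPrimes

variable {P : Type*} {σ : Multiset P →+ ℤ} {p₁ p₂ q r : P} {d₁ d₂ m : ℕ}

theorem class_block (h : SpecialPrimes σ p₁ p₂ q r d₁ d₂ m) (a b c e : ℕ) :
    σ (block p₁ p₂ q r a b c e) = 0 ↔ ZeroSum d₁ d₂ m a b c e := by
  have : σ (block p₁ p₂ q r a b c e) =
      d₁ * d₂ * c + (d₁ + d₂ + m * d₁ * d₂) * e - (d₁ * a + d₂ * b) := by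
    simp only [block, map_add, ← Multiset.nsmul_singleton, map_nsmul, h.class_left, h.class_right,
      h.class_mul, h.class_add]
    simp only [nsmul_eq_mul]
    ring
  rw [this, sub_eq_zero]
  unfold ZeroSum
  zify
  exact eq_comm

/-- The four classes are pairwise different, hence so are the primes, and multiplicities recover the
exponents. -/
theorem block_inj (h : SpecialPrimes σ p₁ p₂ q r d₁ d₂ m) {a b c e a' b' c' e' : ℕ} :
    block p₁ p₂ q r a b c e = block p₁ p₂ q r a' b' c' e' ↔
      a = a' ∧ b = b' ∧ c = c' ∧ e = e' := by
  classical
  have h1 := h.one_lt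
  have h2 := h.lt
  have hd : (0 : ℤ) < d₁ * d₂ := by
    have : 0 < d₁ * d₂ := Nat.mul_pos (by omega) (by omega)
    exact_mod_cast this
  have hn : (d₁ : ℤ) * d₂ < d₁ + d₂ + m * d₁ * d₂ := by
    have hm : (1 : ℤ) ≤ m := by exact_mod_cast h.pos
    have := mul_le_mul_of_nonneg_right hm hd.le
    have h3 : (0 : ℤ) < d₁ := by omega
    have h4 : (0 : ℤ) < d₂ := by omega
    linarith
  have hne : ∀ {x y : P}, σ {x} ≠ σ {y} → x ≠ y := by
    rintro x y hxy rfl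
    exact hxy rfl
  have n12 : p₁ ≠ p₂ := hne (by rw [h.class_left, h.class_right]; omega)
  have n1q : p₁ ≠ q := hne (by rw [h.class_left, h.class_mul]; omega)
  have n1r : p₁ ≠ r := hne (by rw [h.class_left, h.class_add]; omega)
  have n2q : p₂ ≠ q := hne (by rw [h.class_right, h.class_mul]; omega)
  have n2r : p₂ ≠ r := hne (by rw [h.class_right, h.class_add]; omega)
  have nqr : q ≠ r := hne (by rw [h.class_mul, h.class_add]; omega)
  constructor
  · intro heq
    have c1 := congrArg (Multiset.count p₁) heq
    have c2 := congrArg (Multiset.count p₂) heq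
    have c3 := congrArg (Multiset.count q) heq
    have c4 := congrArg (Multiset.count r) heq
    simp [block, Multiset.count_replicate, n12, n12.symm, n1q, n1q.symm, n1r, n1r.symm, n2q,
      n2q.symm, n2r, n2r.symm, nqr, nqr.symm] at c1 c2 c3 c4
    exact ⟨c1, c2, c3, c4⟩
  · rintro ⟨rfl, rfl, rfl, rfl⟩
    rfl

theorem exists_atom {H : Type*} [CancelCommMonoid H] {ψ : Associates H → Multiset P}
    (h : SpecialPrimes σ p₁ p₂ q r d₁ d₂ m) (hψ : DivisorModel σ ψ) {a b c e : ℕ}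
    (hz : ZeroSum d₁ d₂ m a b c e) (h0 : 0 < a + b + c + e)
    (hmin : ∀ a' ≤ a, ∀ b' ≤ b, ∀ c' ≤ c, ∀ e' ≤ e, ZeroSum d₁ d₂ m a' b' c' e' →
      (a' = 0 ∧ b' = 0 ∧ c' = 0 ∧ e' = 0) ∨ (a' = a ∧ b' = b ∧ c' = c ∧ e' = e)) :
    ∃ u : AtomRed H, ψ u = block p₁ p₂ q r a b c e := by
  refine hψ.exists_atom ((h.class_block a b c e).2 hz) ?_ ?_
  · rw [← block_zero (p₁ := p₁) (p₂ := p₂) (q := q) (r := r), Ne, h.block_inj]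
    omega
  · intro k hk hσ
    obtain ⟨a', ha, b', hb, c', hc, e', he, rfl⟩ := exists_eq_block_of_le hk
    rcases hmin a' ha b' hb c' hc e' he ((h.class_block _ _ _ _).1 hσ) with
      ⟨rfl, rfl, rfl, rfl⟩ | ⟨rfl, rfl, rfl, rfl⟩
    · exact Or.inl block_zero
    · exact Or.inr rfl

end SpecialPrimes

/-! ### The atoms supported on the four primes. -/

/-- The atoms `q p₁^d₂`, `q p₂^d₁`, `r^d₁ p₁ⁿ`, `r^d₂ p₂ⁿ` and
`r p₁^(1 + i d₂) p₂^(1 + (m - i) d₁)`, where `n = d₁ + d₂ + m d₁ d₂`. -/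
structure SpecialAtoms {H P : Type*} [CancelCommMonoid H] (ψ : Associates H → Multiset P)
    (p₁ p₂ q r : P) (d₁ d₂ m : ℕ) where
  U₁ : AtomRed H
  U₂ : AtomRed H
  W₁ : AtomRed H
  W₂ : AtomRed H
  V : Fin (m + 1) → AtomRed H
  map_U₁ : ψ U₁ = block p₁ p₂ q r d₂ 0 1 0
  map_U₂ : ψ U₂ = block p₁ p₂ q r 0 d₁ 1 0
  map_W₁ : ψ W₁ = block p₁ p₂ q r (d₁ + d₂ + m * d₁ * d₂) 0 0 d₁
  map_W₂ : ψ W₂ = block p₁ p₂ q r 0 (d₁ + d₂ + m * d₁ * d₂) 0 d₂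
  map_V : ∀ i, ψ (V i) = block p₁ p₂ q r (1 + i * d₂) (1 + (m - i) * d₁) 0 1

theorem SpecialPrimes.nonempty_specialAtoms {H P : Type*} [CancelCommMonoid H]
    {σ : Multiset P →+ ℤ} {ψ : Associates H → Multiset P} {p₁ p₂ q r : P} {d₁ d₂ m : ℕ}
    (h : SpecialPrimes σ p₁ p₂ q r d₁ d₂ m) (hψ : DivisorModel σ ψ) :
    Nonempty (SpecialAtoms ψ p₁ p₂ q r d₁ d₂ m) := by
  have h1 : 0 < d₁ := by have := h.one_lt; omega
  have h2 : 0 < d₂ := by have := h.lt; omega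
  obtain ⟨U₁, hU₁⟩ := h.exists_atom hψ (a := d₂) (b := 0) (c := 1) (e := 0)
    (by unfold ZeroSum; ring) (by omega) (by
      intro a _ b hb c hc e he hz
      obtain rfl : b = 0 := by omega
      obtain rfl : e = 0 := by omega
      have := hz.minimal_left h1 hc
      omega)
  obtain ⟨U₂, hU₂⟩ := h.exists_atom hψ (a := 0) (b := d₁) (c := 1) (e := 0)
    (by unfold ZeroSum; ring) (by omega) (by
      intro a ha b _ c hc e he hz
      obtain rfl : a = 0 := by omega
      obtain rfl : e = 0 := by omega
      have := hz.minimal_right h2 hc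
      omega)
  obtain ⟨W₁, hW₁⟩ := h.exists_atom hψ (a := d₁ + d₂ + m * d₁ * d₂) (b := 0) (c := 0) (e := d₁)
    (by unfold ZeroSum; ring) (by omega) (by
      intro a _ b hb c hc e he hz
      obtain rfl : b = 0 := by omega
      obtain rfl : c = 0 := by omega
      have := hz.minimal_pure_left h1 h.coprime he
      omega)
  obtain ⟨W₂, hW₂⟩ := h.exists_atom hψ (a := 0) (b := d₁ + d₂ + m * d₁ * d₂) (c := 0) (e := d₂)
    (by unfold ZeroSum; ring) (by omega) (by
      intro a ha b _ c hc e he hz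
      obtain rfl : a = 0 := by omega
      obtain rfl : c = 0 := by omega
      have := hz.minimal_pure_right h2 h.coprime he
      omega)
  have hV : ∀ i : Fin (m + 1), ∃ u : AtomRed H,
      ψ u = block p₁ p₂ q r (1 + i * d₂) (1 + (m - i) * d₁) 0 1 := by
    intro i
    have hi : (i : ℕ) ≤ m := by omega
    refine h.exists_atom hψ ?_ (by omega) ?_
    · unfold ZeroSum
      obtain ⟨j, hj⟩ := Nat.exists_eq_add_of_le hi
      have hs : m - i = j := by omega
      rw [hs]
      generalize (i : ℕ) = i at hj
      subst hj
      ring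
    · intro a ha b hb c hc e he hz
      obtain rfl : c = 0 := by omega
      have := hz.minimal_mixed h1 h2 hi ha hb he
      omega
  choose V hV using hV
  exact ⟨⟨U₁, U₂, W₁, W₂, V, hU₁, hU₂, hW₁, hW₂, hV⟩⟩

namespace SpecialAtoms

variable {H P : Type*} [CancelCommMonoid H] {σ : Multiset P →+ ℤ} {ψ : Associates H → Multiset P}
  {p₁ p₂ q r : P} {d₁ d₂ m : ℕ}

/-- The factorization with prescribed multiplicities of the special atoms. -/
def fact (S : SpecialAtoms ψ p₁ p₂ q r d₁ d₂ m) (w₁ w₂ u₁ u₂ : ℕ) (L : Multiset (Fin (m + 1))) :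
    Factorization H :=
  Multiset.replicate w₁ S.W₁ + Multiset.replicate w₂ S.W₂ + Multiset.replicate u₁ S.U₁ +
    Multiset.replicate u₂ S.U₂ + L.map S.V

theorem card_fact (S : SpecialAtoms ψ p₁ p₂ q r d₁ d₂ m) (w₁ w₂ u₁ u₂ : ℕ)
    (L : Multiset (Fin (m + 1))) :
    Multiset.card (S.fact w₁ w₂ u₁ u₂ L) = w₁ + w₂ + u₁ + u₂ + Multiset.card L := by
  simp [fact]

theorem sum_map_V (S : SpecialAtoms ψ p₁ p₂ q r d₁ d₂ m) (L : Multiset (Fin (m + 1))) :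
    ((L.map S.V).map fun u => ψ u.1).sum =
      block p₁ p₂ q r (Multiset.card L + d₂ * (L.map Fin.val).sum)
        (L.map fun i : Fin (m + 1) => 1 + (m - (i : ℕ)) * d₁).sum 0 (Multiset.card L) := by
  induction L using Multiset.induction with
  | empty => simp [block]
  | cons i L ih =>
    simp only [Multiset.map_cons, Multiset.sum_cons, Multiset.card_cons, ih, S.map_V, block_add]
    congr 1 <;> ring

theorem sum_fact (S : SpecialAtoms ψ p₁ p₂ q r d₁ d₂ m) (w₁ w₂ u₁ u₂ : ℕ)
    (L : Multiset (Fin (m + 1))) :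
    ((S.fact w₁ w₂ u₁ u₂ L).map fun u => ψ u.1).sum =
      block p₁ p₂ q r
        ((d₁ + d₂ + m * d₁ * d₂) * w₁ + d₂ * u₁ + Multiset.card L + d₂ * (L.map Fin.val).sum)
        ((d₁ + d₂ + m * d₁ * d₂) * w₂ + d₁ * u₂ +
          (L.map fun i : Fin (m + 1) => 1 + (m - (i : ℕ)) * d₁).sum)
        (u₁ + u₂) (d₁ * w₁ + d₂ * w₂ + Multiset.card L) := by
  simp only [fact, Multiset.map_add, Multiset.sum_add, sum_map_V, Multiset.map_replicate,
    Multiset.sum_replicate, S.map_U₁, S.map_U₂, S.map_W₁, S.map_W₂, nsmul_block, block_add]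
  congr 1 <;> ring

/-- Every atom supported on the special primes is one of the special atoms. -/
theorem atom_cases (S : SpecialAtoms ψ p₁ p₂ q r d₁ d₂ m) (h : SpecialPrimes σ p₁ p₂ q r d₁ d₂ m)
    (hψ : DivisorModel σ ψ) {u : AtomRed H} {a b c e : ℕ}
    (hu : ψ u.1 ≤ block p₁ p₂ q r a b c e) :
    u = S.U₁ ∨ u = S.U₂ ∨ u = S.W₁ ∨ u = S.W₂ ∨ ∃ i, u = S.V i := by
  have h1 : 0 < d₁ := by have := h.one_lt; omega
  have h2 : 0 < d₂ := by have := h.lt; omega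
  obtain ⟨a, -, b, -, c, -, e, -, hu⟩ := exists_eq_block_of_le hu
  have hz : ZeroSum d₁ d₂ m a b c e := by
    rw [← h.class_block, ← hu]
    exact hψ.class_eq_zero _
  have h0 : 0 < a + b + c + e := by
    rw [Nat.pos_iff_ne_zero]
    intro h0
    obtain ⟨rfl, rfl, rfl, rfl⟩ : a = 0 ∧ b = 0 ∧ c = 0 ∧ e = 0 := by omega
    rw [block_zero, hψ.eq_one_iff] at hu
    exact u.2.ne_one hu
  -- Comparable atoms coincide, so dominating a basic solution identifies `u`.
  have key : ∀ v : AtomRed H, ψ v.1 ≤ ψ u.1 → u = v := by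
    intro v hv
    apply Subtype.ext
    apply hψ.injective
    refine hψ.eq_of_le_irreducible u.2 hv (hψ.class_eq_zero _) ?_
    rw [Ne, hψ.eq_one_iff]
    exact v.2.ne_one
  rcases hz.dominates h1 h2 h.pos h.coprime h0 with
    ⟨ha, hc⟩ | ⟨hb, hc⟩ | ⟨ha, he⟩ | ⟨hb, he⟩ | ⟨i, hi, ha, hb, he⟩
  · exact Or.inl (key _ (by
      rw [S.map_U₁, hu]; exact block_le_block ha (Nat.zero_le _) hc (Nat.zero_le _)))
  · exact Or.inr (Or.inl (key _ (by
      rw [S.map_U₂, hu]; exact block_le_block (Nat.zero_le _) hb hc (Nat.zero_le _))))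
  · exact Or.inr (Or.inr (Or.inl (key _ (by
      rw [S.map_W₁, hu]; exact block_le_block ha (Nat.zero_le _) (Nat.zero_le _) he))))
  · exact Or.inr (Or.inr (Or.inr (Or.inl (key _ (by
      rw [S.map_W₂, hu]; exact block_le_block (Nat.zero_le _) hb (Nat.zero_le _) he)))))
  · exact Or.inr (Or.inr (Or.inr (Or.inr ⟨⟨i, by omega⟩, key _ (by
      rw [S.map_V, hu]; exact block_le_block ha hb (Nat.zero_le _) he)⟩)))

theorem exists_eq_fact (S : SpecialAtoms ψ p₁ p₂ q r d₁ d₂ m) (z : Factorization H)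
    (hz : ∀ u ∈ z, u = S.U₁ ∨ u = S.U₂ ∨ u = S.W₁ ∨ u = S.W₂ ∨ ∃ i, u = S.V i) :
    ∃ w₁ w₂ u₁ u₂ L, z = S.fact w₁ w₂ u₁ u₂ L := by
  induction z using Multiset.induction with
  | empty => exact ⟨0, 0, 0, 0, 0, by simp [fact]⟩
  | cons u z ih =>
    obtain ⟨w₁, w₂, u₁, u₂, L, rfl⟩ := ih fun u hu => hz u (Multiset.mem_cons_of_mem hu)
    rcases hz u (Multiset.mem_cons_self _ _) with rfl | rfl | rfl | rfl | ⟨i, rfl⟩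
    · exact ⟨w₁, w₂, u₁ + 1, u₂, L, by simp [fact, Multiset.replicate_succ]⟩
    · exact ⟨w₁, w₂, u₁, u₂ + 1, L, by simp [fact, Multiset.replicate_succ]⟩
    · exact ⟨w₁ + 1, w₂, u₁, u₂, L, by simp [fact, Multiset.replicate_succ]⟩
    · exact ⟨w₁, w₂ + 1, u₁, u₂, L, by simp [fact, Multiset.replicate_succ]⟩
    · exact ⟨w₁, w₂, u₁, u₂, i ::ₘ L, by simp [fact]⟩

theorem sum_val_le (L : Multiset (Fin (m + 1))) :
    (L.map Fin.val).sum ≤ m * Multiset.card L := by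
  have := Multiset.sum_le_card_nsmul (L.map Fin.val) m (by
    intro x hx
    obtain ⟨i, -, rfl⟩ := Multiset.mem_map.1 hx
    omega)
  simpa [mul_comm] using this

theorem eq_replicate_of_sum_val_eq_zero {L : Multiset (Fin (m + 1))}
    (h : (L.map Fin.val).sum = 0) : L = Multiset.replicate (Multiset.card L) 0 := by
  rw [Multiset.eq_replicate]
  refine ⟨rfl, fun i hi => ?_⟩
  rw [Multiset.sum_eq_zero_iff] at h
  exact Fin.ext (h _ (Multiset.mem_map_of_mem _ hi))

/-- The factorization `W₁^W V₀^(d₂ - 1) U₂^B`. -/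
def base (S : SpecialAtoms ψ p₁ p₂ q r d₁ d₂ m) (W B : ℕ) : Factorization H :=
  S.fact W 0 0 B (Multiset.replicate (d₂ - 1) 0)

/-- The factorizations of the product of `base` involving no `V i` with `i ≠ 0`. -/
theorem fact_mem (S : SpecialAtoms ψ p₁ p₂ q r d₁ d₂ m) (hψ : DivisorModel σ ψ)
    {W B x y u₁ u₂ v : ℕ} (hd : 0 < d₂) (hv : v + d₂ * y = d₁ * x + (d₂ - 1))
    (hu : u₁ = y + x * (1 + m * d₁)) (hB : u₁ + u₂ = B) :
    factProd (S.fact W y u₁ u₂ (Multiset.replicate v 0)) = factProd (S.base (W + x) B) := by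
  apply hψ.injective
  rw [hψ.map_factProd, hψ.map_factProd, base, sum_fact, sum_fact]
  obtain ⟨t, rfl⟩ : ∃ t, d₂ = t + 1 := ⟨d₂ - 1, by omega⟩
  simp only [Nat.add_sub_cancel] at hv
  subst hu
  subst hB
  simp only [Multiset.card_replicate, Multiset.map_replicate, Multiset.sum_replicate, Fin.val_zero,
    smul_eq_mul, Nat.add_sub_cancel, Nat.sub_zero]
  congr 1
  · zify at *
    have : (v : ℤ) = d₁ * x + t - (t + 1) * y := by linarith
    rw [this]; ring
  · zify at *
    have : (v : ℤ) = d₁ * x + t - (t + 1) * y := by linarith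
    rw [this]; ring
  · ring
  · linarith

end SpecialAtoms

/-! ### Isolation of the base factorization. -/

namespace SpecialAtoms

variable {H P : Type*} [CancelCommMonoid H] {σ : Multiset P →+ ℤ} {ψ : Associates H → Multiset P}
  {p₁ p₂ q r : P} {d₁ d₂ m : ℕ}

/-- A factorization with the same product as `base` has exponents satisfying the balance
equations. -/
theorem exists_balanced (S : SpecialAtoms ψ p₁ p₂ q r d₁ d₂ m)
    (h : SpecialPrimes σ p₁ p₂ q r d₁ d₂ m) (hψ : DivisorModel σ ψ) {W B : ℕ}
    {z : Factorization H} (hz : factProd z = factProd (S.base W B)) :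
    ∃ w₁ w₂ u₁ u₂ L, z = S.fact w₁ w₂ u₁ u₂ L ∧
      d₁ * w₁ + d₂ * w₂ + Multiset.card L = d₁ * W + (d₂ - 1) ∧ u₁ + u₂ = B ∧
      (d₁ + d₂ + m * d₁ * d₂) * w₁ + d₂ * u₁ + Multiset.card L + d₂ * (L.map Fin.val).sum
        = (d₁ + d₂ + m * d₁ * d₂) * W + (d₂ - 1) := by
  obtain ⟨w₁, w₂, u₁, u₂, L, rfl⟩ := S.exists_eq_fact z fun u hu => by
    have hle := hψ.le_of_mem hu
    rw [hz, hψ.map_factProd, base, sum_fact] at hle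
    exact S.atom_cases h hψ hle
  refine ⟨w₁, w₂, u₁, u₂, L, rfl, ?_⟩
  have heq := congrArg ψ hz
  rw [hψ.map_factProd, hψ.map_factProd, base, sum_fact, sum_fact, h.block_inj] at heq
  -- The count of p₂ is redundant: both divisors have class zero, so the other three counts
  -- determine it.
  obtain ⟨ha, -, hc, he⟩ := heq
  simp only [Multiset.card_replicate, Multiset.map_replicate, Multiset.sum_replicate,
    Fin.val_zero, smul_zero, mul_zero, add_zero, zero_add] at ha hc he
  exact ⟨he, hc, ha⟩

/-- Each special atom contains q or r, so the length is at most the number of these primes in the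
divisor. -/
theorem card_le (S : SpecialAtoms ψ p₁ p₂ q r d₁ d₂ m) (h : SpecialPrimes σ p₁ p₂ q r d₁ d₂ m)
    (hψ : DivisorModel σ ψ) {W B : ℕ} {z : Factorization H}
    (hz : factProd z = factProd (S.base W B)) :
    Multiset.card z ≤ d₁ * W + (d₂ - 1) + B := by
  obtain ⟨w₁, w₂, u₁, u₂, L, rfl, he, hc, -⟩ := S.exists_balanced h hψ hz
  have h1 : 0 < d₁ := by have := h.one_lt; omega
  have h2 : 0 < d₂ := by have := h.lt; omega
  have := Nat.le_mul_of_pos_left w₁ h1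
  have := Nat.le_mul_of_pos_left w₂ h2
  rw [card_fact]
  omega

/-- Ensures that every copy of W₂ or U₁ in another factorization counts in full towards the
distance. -/
theorem notMem_base (S : SpecialAtoms ψ p₁ p₂ q r d₁ d₂ m)
    (h : SpecialPrimes σ p₁ p₂ q r d₁ d₂ m) (W B : ℕ) :
    S.W₂ ∉ S.base W B ∧ S.U₁ ∉ S.base W B := by
  have h1 := h.one_lt
  have h2 := h.lt
  have hne : ∀ {u v : AtomRed H}, ψ u.1 ≠ ψ v.1 → u ≠ v := by
    rintro u v huv rfl
    exact huv rfl
  have aux : ∀ u : AtomRed H, u ∈ S.base W B → u = S.W₁ ∨ u = S.U₂ ∨ u = S.V 0 := by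
    intro u hu
    simp only [base, fact, Multiset.mem_add, Multiset.map_replicate] at hu
    rcases hu with (((hu | hu) | hu) | hu) | hu
    · exact Or.inl (Multiset.eq_of_mem_replicate hu)
    · simp at hu
    · simp at hu
    · exact Or.inr (Or.inl (Multiset.eq_of_mem_replicate hu))
    · exact Or.inr (Or.inr (Multiset.eq_of_mem_replicate hu))
  constructor
  · intro hu
    rcases aux _ hu with hu | hu | hu <;> refine hne ?_ hu <;>
      simp only [S.map_W₁, S.map_W₂, S.map_U₂, S.map_V, Ne, h.block_inj] <;> omega
  · intro hu
    rcases aux _ hu with hu | hu | hu <;> refine hne ?_ hu <;>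
      simp only [S.map_W₁, S.map_U₁, S.map_U₂, S.map_V, Ne, h.block_inj] <;> omega

/-- The factorization `base` is far from all other factorizations that are not too long. -/
theorem lt_factDist_base (S : SpecialAtoms ψ p₁ p₂ q r d₁ d₂ m)
    (h : SpecialPrimes σ p₁ p₂ q r d₁ d₂ m) (hψ : DivisorModel σ ψ) (h3 : 3 ≤ d₁) {W B : ℕ}
    {z : Factorization H} (hz : factProd z = factProd (S.base W B))
    (hlen : Multiset.card z ≤ Multiset.card (S.base W B) + (d₁ - 2)) (hne : z ≠ S.base W B) :
    m < factDist (S.base W B) z := by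
  obtain ⟨w₁, w₂, u₁, u₂, L, rfl, he, hc, ha⟩ := S.exists_balanced h hψ hz
  obtain ⟨n1, n2⟩ := S.notMem_base h W B
  rw [base, card_fact, card_fact, Multiset.card_replicate] at hlen
  rcases exponents_rigid h3 h.lt (sum_val_le L) he hc ha (by omega) with
    hw | hu | ⟨rfl, rfl, hv, rfl, hs⟩
  · refine hw.trans_le (le_factDist_of_replicate_le n1 ?_)
    rw [fact, Multiset.le_iff_exists_add]
    exact ⟨Multiset.replicate w₁ S.W₁ + Multiset.replicate u₁ S.U₁ +
      Multiset.replicate u₂ S.U₂ + L.map S.V, by abel⟩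
  · refine hu.trans_le (le_factDist_of_replicate_le n2 ?_)
    rw [fact, Multiset.le_iff_exists_add]
    exact ⟨Multiset.replicate w₁ S.W₁ + Multiset.replicate w₂ S.W₂ +
      Multiset.replicate u₂ S.U₂ + L.map S.V, by abel⟩
  · exfalso
    apply hne
    rw [base, eq_replicate_of_sum_val_eq_zero hs, hv]
    congr 1
    omega

end SpecialAtoms

/-! ### Choice of the element and of the primes. -/

/-- Existence of factorizations that are isolated among all factorizations that are not too long,
with prescribed distance to the ends of the set of lengths. -/
theorem SpecialPrimes.exists_isolated {H P : Type*} [CancelCommMonoid H] {σ : Multiset P →+ ℤ}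
    {ψ : Associates H → Multiset P} {p₁ p₂ q r : P} {d₁ d₂ m : ℕ}
    (h : SpecialPrimes σ p₁ p₂ q r d₁ d₂ m) (hψ : DivisorModel σ ψ) (h3 : 3 ≤ d₁) (N : ℕ) :
    ∃ a : H, ∃ z ∈ factorizations a, ∃ z' ∈ factorizations a,
      Multiset.card z' = Multiset.card z + Nat.gcd (d₁ - 1) (d₂ - 1) ∧
      (∃ lmin lmax : ℕ, IsLeast (lengths a) lmin ∧ IsGreatest (lengths a) lmax ∧
        lmin + N ≤ Multiset.card z ∧ Multiset.card z + N ≤ lmax) ∧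
      ∀ y ∈ factorizations a, Multiset.card y ≤ Multiset.card z + (d₁ - 2) → y ≠ z →
        m < factDist z y := by
  classical
  obtain ⟨S⟩ := h.nonempty_specialAtoms hψ
  have hlt := h.lt
  obtain ⟨x, y, hxy, hyx⟩ := exists_length_shift h3 hlt
  -- `W` and `B` are the sums of the copies of W₁ given up and of U₁ needed in the three exchanges
  -- below, so each is possible.
  set W := x + d₂ * N + N
  set B := (y + x * (1 + m * d₁)) + (d₁ * N + d₂ * N * (1 + m * d₁)) + N * (1 + m * d₁)
  obtain ⟨a, ha⟩ := Associates.exists_rep (factProd (S.base W B))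
  have hfac : ∀ z, z ∈ factorizations a ↔ factProd z = factProd (S.base W B) := by
    intro z
    rw [← ha]
    rfl
  have hcard : Multiset.card (S.base W B) = W + B + (d₂ - 1) := by
    rw [SpecialAtoms.base, SpecialAtoms.card_fact, Multiset.card_replicate]
    omega
  have hmem : ∀ w x' y' v, w + x' = W → y' + x' * (1 + m * d₁) ≤ B →
      v + d₂ * y' = d₁ * x' + (d₂ - 1) →
      ∃ z ∈ factorizations a, Multiset.card z = w + y' + B + v := by
    intro w x' y' v hw hB hv
    refine ⟨S.fact w y' (y' + x' * (1 + m * d₁)) (B - (y' + x' * (1 + m * d₁)))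
      (Multiset.replicate v 0), ?_, ?_⟩
    · rw [hfac, ← hw]
      exact S.fact_mem hψ (by omega) hv rfl (by omega)
    · rw [SpecialAtoms.card_fact, Multiset.card_replicate]
      omega
  obtain ⟨z', hz', hz'c⟩ := hmem (d₂ * N + N) x y (d₁ * x + (d₂ - 1) - d₂ * y) (by omega)
    (by omega) (by omega)
  -- Trading d₂N copies of W₁ for d₁N of W₂ shortens by (d₂ - d₁)N ≥ N; trading N copies of W₁
  -- without W₂ lengthens by (d₁ - 1)N ≥ N.
  obtain ⟨zs, hzs, hzsc⟩ := hmem (x + N) (d₂ * N) (d₁ * N) (d₂ - 1) (by omega) (by omega)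
    (by ring)
  obtain ⟨zl, hzl, hzlc⟩ := hmem (x + d₂ * N) N 0 (d₁ * N + (d₂ - 1)) (by omega) (by omega)
    (by omega)
  have hlN : d₁ * N + N ≤ d₂ * N := by
    have := Nat.mul_le_mul_right N (Nat.succ_le_of_lt hlt)
    rwa [Nat.succ_mul] at this
  have h2N : 2 * N ≤ d₁ * N := Nat.mul_le_mul_right N (by omega)
  refine ⟨a, S.base W B, (hfac _).2 rfl, z', hz', ?_, ?_, ?_⟩
  · rw [hcard, hz'c]
    rw [Nat.sub_mul, one_mul, Nat.sub_mul, one_mul] at hxy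
    have := Nat.le_mul_of_pos_left x (show 0 < d₁ by omega)
    have := Nat.le_mul_of_pos_left y (show 0 < d₂ by omega)
    omega
  · have hne : ∃ l, l ∈ lengths a := ⟨_, z', hz', rfl⟩
    have hbdd : ∀ l ∈ lengths a, l ≤ d₁ * W + (d₂ - 1) + B := by
      rintro _ ⟨z, hz, rfl⟩
      exact S.card_le h hψ ((hfac z).1 hz)
    refine ⟨Nat.find hne, Nat.findGreatest (· ∈ lengths a) (d₁ * W + (d₂ - 1) + B),
      ⟨Nat.find_spec hne, fun l hl => Nat.find_min' hne hl⟩,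
      ⟨Nat.findGreatest_spec (P := (· ∈ lengths a)) (hbdd _ ⟨z', hz', rfl⟩) ⟨z', hz', rfl⟩,
        fun l hl => Nat.le_findGreatest (hbdd l hl) hl⟩, ?_, ?_⟩
    · have : Nat.find hne ≤ Multiset.card zs := Nat.find_min' hne ⟨zs, hzs, rfl⟩
      omega
    · have : Multiset.card zl ≤ Nat.findGreatest (· ∈ lengths a) (d₁ * W + (d₂ - 1) + B) :=
        Nat.le_findGreatest (hbdd _ ⟨zl, hzl, rfl⟩) ⟨zl, hzl, rfl⟩
      omega
  · intro y hy hlen hne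
    exact S.lt_factDist_base h hψ h3 ((hfac y).1 hy) hlen hne

/-- An infinite set of positive classes has a member above d₁ + d₂ + M d₁d₂; the congruence then
writes it with some m > M. -/
theorem exists_specialPrimes {H P : Type*} [CancelCommMonoid H] {φ : H →* FreeAbMonoid P}
    {Φ : ClassGroupOf φ ≃* Multiplicative ℤ} {d₁ d₂ : ℕ} (h1 : 1 < d₁) (hlt : d₁ < d₂)
    (hgcd : Nat.gcd d₁ d₂ = 1)
    (h₁ : -(d₁ : ℤ) ∈ primeClasses φ Φ) (h₂ : -(d₂ : ℤ) ∈ primeClasses φ Φ)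
    (h₁₂ : (d₁ : ℤ) * (d₂ : ℤ) ∈ primeClasses φ Φ)
    (hinf : {g : ℤ | g ∈ primeClasses φ Φ ∧ 0 < g ∧
      g ≡ (d₁ : ℤ) + (d₂ : ℤ) [ZMOD (d₁ : ℤ) * (d₂ : ℤ)]}.Infinite) (M : ℕ) :
    ∃ p₁ p₂ q r m, M ≤ m ∧ SpecialPrimes (classMap φ Φ) p₁ p₂ q r d₁ d₂ m := by
  obtain ⟨p₁, hp₁⟩ := h₁
  obtain ⟨p₂, hp₂⟩ := h₂
  obtain ⟨q, hq⟩ := h₁₂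
  have hd : (0 : ℤ) < d₁ * d₂ := by
    have : 0 < d₁ * d₂ := Nat.mul_pos (by omega) (by omega)
    exact_mod_cast this
  obtain ⟨g, ⟨⟨r, hr⟩, hg0, hmod⟩, hg⟩ := hinf.exists_notMem_finite
    (Set.finite_Icc 0 ((d₁ : ℤ) + d₂ + M * (d₁ * d₂)))
  have hg : (d₁ : ℤ) + d₂ + M * (d₁ * d₂) < g := by
    rw [Set.mem_Icc, not_and_or] at hg
    omega
  obtain ⟨k, hk⟩ := hmod.symm.dvd
  have hMk : (M : ℤ) < k := by
    have : (d₁ : ℤ) * d₂ * M < d₁ * d₂ * k := by rw [← hk]; linarith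
    exact lt_of_mul_lt_mul_left this hd.le
  obtain ⟨m, rfl⟩ := Int.eq_ofNat_of_zero_le (show 0 ≤ k by omega)
  refine ⟨p₁, p₂, q, r, m, by omega, h1, hlt, hgcd, by omega, hp₁, hp₂, hq, hr.trans ?_⟩
  linarith

end FactorizationTheory

open FactorizationTheory

theorem proposition7p1 {H P : Type*} [CancelCommMonoid H]
    (φ : H →* FreeAbMonoid P) (hdiv : IsDivisorHom φ) (hcof : IsCofinal φ)
    (Φ : ClassGroupOf φ ≃* Multiplicative ℤ)
    (d₁ d₂ : ℕ) (h3 : 3 ≤ d₁) (hlt : d₁ < d₂) (hgcd : Nat.gcd d₁ d₂ = 1)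
    (hndvd : ¬ (d₁ - 1) ∣ (d₂ - 1))
    (h₁ : -(d₁ : ℤ) ∈ primeClasses φ Φ) (h₂ : -(d₂ : ℤ) ∈ primeClasses φ Φ)
    (h₁₂ : (d₁ : ℤ) * (d₂ : ℤ) ∈ primeClasses φ Φ)
    (hinf : {g : ℤ | g ∈ primeClasses φ Φ ∧ 0 < g ∧
      g ≡ (d₁ : ℤ) + (d₂ : ℤ) [ZMOD (d₁ : ℤ) * (d₂ : ℤ)]}.Infinite) :
    (∀ M N : ℕ, ∃ a : H, ∃ z ∈ factorizations a, ∃ z' ∈ factorizations a,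
      (Multiset.card z' = Multiset.card z + Nat.gcd (d₁ - 1) (d₂ - 1) ∧
        Multiset.card z + Nat.gcd (d₁ - 1) (d₂ - 1) ≤ Multiset.card z + (d₁ - 2)) ∧
      (∃ lmin lmax : ℕ, IsLeast (lengths a) lmin ∧ IsGreatest (lengths a) lmax ∧
        lmin + N ≤ Multiset.card z ∧ Multiset.card z + N ≤ lmax) ∧
      (M : ℕ∞) < factSetDist {z}
        ((⋃ i ∈ Set.Icc 1 (Multiset.card z + (d₁ - 2)), factorizationsOfLength a i) \ {z})) ∧
    monCatenaryDegree H = ⊤ ∧ successiveDistance H = ⊤ := by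
  have hg0 : 0 < Nat.gcd (d₁ - 1) (d₂ - 1) := Nat.gcd_pos_of_pos_left _ (by omega)
  -- The gcd is a divisor of d₁ - 1, and a proper one by non-divisibility.
  have hg : Nat.gcd (d₁ - 1) (d₂ - 1) ≤ d₁ - 2 := by
    have hle := Nat.le_of_dvd (by omega) (Nat.gcd_dvd_left (d₁ - 1) (d₂ - 1))
    have hne : Nat.gcd (d₁ - 1) (d₂ - 1) ≠ d₁ - 1 := fun h =>
      hndvd (h ▸ Nat.gcd_dvd_right (d₁ - 1) (d₂ - 1))
    omega
  obtain ⟨ψ, hψ⟩ := exists_divisorModel hdiv Φ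
  have key : ∀ M N : ℕ, ∃ a : H, ∃ z ∈ factorizations a, ∃ z' ∈ factorizations a,
      Multiset.card z' = Multiset.card z + Nat.gcd (d₁ - 1) (d₂ - 1) ∧
      (∃ lmin lmax : ℕ, IsLeast (lengths a) lmin ∧ IsGreatest (lengths a) lmax ∧
        lmin + N ≤ Multiset.card z ∧ Multiset.card z + N ≤ lmax) ∧
      ∀ y ∈ factorizations a, Multiset.card y ≤ Multiset.card z + (d₁ - 2) → y ≠ z →
        M < factDist z y := by
    intro M N
    obtain ⟨p₁, p₂, q, r, m, hm, hS⟩ :=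
      exists_specialPrimes (by omega) hlt hgcd h₁ h₂ h₁₂ hinf M
    obtain ⟨a, z, hz, z', hz', hc, hl, hfar⟩ := hS.exists_isolated hψ h3 N
    exact ⟨a, z, hz, z', hz', hc, hl, fun y hy hle hne => hm.trans_lt (hfar y hy hle hne)⟩
  refine ⟨fun M N => ?_, ?_, ?_⟩
  · obtain ⟨a, z, hz, z', hz', hc, hl, hfar⟩ := key M N
    refine ⟨a, z, hz, z', hz', ⟨hc, by omega⟩, hl, ?_⟩
    refine lt_of_lt_of_le (b := ((M + 1 : ℕ) : ℕ∞)) (by exact_mod_cast Nat.lt_succ_self M) ?_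
    refine le_iInf₂ fun x hx => le_iInf₂ fun y hy => ?_
    obtain rfl : x = z := hx
    obtain ⟨hy, hne⟩ := hy
    simp only [Set.mem_iUnion] at hy
    obtain ⟨i, hi, hy, hyi⟩ := hy
    have := hfar y hy (by rw [hyi]; exact hi.2) hne
    exact_mod_cast this
  · refine ENat.eq_top_iff_forall_ge.2 fun M => ?_
    obtain ⟨a, z, hz, z', hz', hc, -, hfar⟩ := key M 0
    exact (lt_monCatenaryDegreeElt hz hz' (by omega)
      fun y hy hle hne => hfar y hy (by omega) hne).le.trans
        (le_iSup (fun a : H => monCatenaryDegreeElt a) a)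
  · refine ENat.eq_top_iff_forall_ge.2 fun M => ?_
    obtain ⟨a, z, hz, z', hz', hc, -, hfar⟩ := key M 0
    exact (le_successiveDistanceAt hz hz' (by omega)
      fun y hy hle hne => hfar y hy (by omega) hne).trans
        (le_iSup (fun z : Factorization H => successiveDistanceAt z) z)
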